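/- Let $m\ge 2$, $\alpha_0>0$ and $0<\gamma<1$. Let $X_1,X_2,\dots$ be i.i.d. from the Pareto distribution $\mathrm{Par}(\beta,\alpha)$ with cdf $1-(\beta/x)^{\alpha}$, $x\ge\beta$, where $\beta>0$ and $\alpha>0$ are both unknown. The observed data are $(\mathbf R,\mathbf K)=(R_1,K_1,\dots,R_m,K_m)$, where $R_i$ is the $i$-th lower record value ($X_1$ being the first record, and $X_j$ being a lower record if it is smaller than all preceding terms), $K_i$ for $i<m$ is the number of trials after $R_i$ needed to obtain $R_{i+1}$, and $K_m=1$. Put $T_2^\star=\sum_{i=1}^{m-1}K_i(\log R_i-\log R_m)$, and let $\chi^2_{v,p}$ be the lower $p$-quantile of the chi-square distribution with $v$ degrees of freedom. A (randomized) test is a measurable function $\phi$ of the data with values in $[0,1]$, giving the probability of rejecting $H_0$. It is invariant if $\phi(r_1/c,k_1,\dots,r_m/c,k_m)=\phi(r_1,k_1,\dots,r_m,k_m)$ for all $c>0$ and all data with $r_1>\dots>r_m>0$, integers $k_i\ge 1$ and $k_m=1$. Its size is $\sup_{(\beta,\alpha)\in H_0}E_{\beta,\alpha}\phi$. An invariant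 test $\phi$ of size $\gamma$ is UMP invariant if $E_{\beta,\alpha}\phi\ge E_{\beta,\alpha}\psi$ for every $(\beta,\alpha)\in H_1$ and every invariant test $\psi$ of size at most $\gamma$. Then: 1. For testing $H_0:\alpha\le\alpha_0$ against $H_1:\alpha>\alpha_0$ (with $\beta>0$ arbitrary), the test that rejects $H_0$ if and only if $2\alpha_0T_2^\star\le\chi^2_{2m-2,\gamma}$ is a UMP invariant test of size $\gamma$. 2. For testing $H_0:\alpha\ge\alpha_0$ against $H_1:\alpha<\alpha_0$ (with $\beta>0$ arbitrary), the test that rejects $H_0$ if and only if $2\alpha_0T_2^\star\ge\chi^2_{2m-2,1-\gamma}$ is a UMP invariant test of size $\gamma$. -/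

import Mathlib

open MeasureTheory ProbabilityTheory

noncomputable section

namespace ParetoRecords

/-! ### Lower record data of a sequence

Sequences are indexed by `ℕ` starting at `0`, and `m = n + 1` is the number of records
that are observed. -/

/-- `x j` is a lower record of the sequence `x`: it is smaller than all preceding terms.
In particular the first term is a record. -/
def IsLowerRecord (x : ℕ → ℝ) (j : ℕ) : Prop :=
  ∀ i < j, x j < x i

/-- The position of the `i`-th lower record (`i = 0` is the first record). -/
def recordTime (x : ℕ → ℝ) (i : ℕ) : ℕ :=
  Nat.nth (IsLowerRecord x) i

/-- Record data `(r, k)`: record values `r` and inter-record numbers of trials `k`. -/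
abbrev RecordData (n : ℕ) : Type :=
  (Fin (n + 1) → ℝ) × (Fin (n + 1) → ℕ)

/-- The record data `(R₁, K₁, …, Rₘ, Kₘ)`, `m = n + 1`, of a sequence, under inverse sampling:
`Rᵢ` is the `i`-th lower record value, `Kᵢ` is, for `i < m`, the number of trials after `Rᵢ` needed
to obtain the next record `Rᵢ₊₁`, and `Kₘ = 1` by convention. -/
def recordData (n : ℕ) (x : ℕ → ℝ) : RecordData n :=
  (fun i => x (recordTime x (i : ℕ)),
   fun i => if i = Fin.last n then 1 else recordTime x ((i : ℕ) + 1) - recordTime x (i : ℕ))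

/-- The sample space of the record data: positive and strictly decreasing record values, positive
numbers of trials, and last number of trials equal to `1`. -/
def sampleSpace (n : ℕ) : Set (RecordData n) :=
  {d | (∀ i, 0 < d.1 i) ∧ StrictAnti d.1 ∧ (∀ i, 1 ≤ d.2 i) ∧ d.2 (Fin.last n) = 1}

/-! ### Measurability of the record data -/

lemma measurableSet_isLowerRecord (j : ℕ) : MeasurableSet {x : ℕ → ℝ | IsLowerRecord x j} := by
  have h : {x : ℕ → ℝ | IsLowerRecord x j} = ⋂ i, ⋂ (_ : i < j), {x : ℕ → ℝ | x j < x i} := by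
    ext x; simp [IsLowerRecord]
  rw [h]
  exact MeasurableSet.iInter fun i => MeasurableSet.iInter fun _ =>
    measurableSet_lt (measurable_pi_apply j) (measurable_pi_apply i)

open Classical in
lemma measurable_count (j : ℕ) :
    Measurable fun x : ℕ → ℝ => Nat.count (IsLowerRecord x) j := by
  induction j with
  | zero => simp
  | succ j ih =>
    simp only [Nat.count_succ]
    exact ih.add (Measurable.ite (measurableSet_isLowerRecord j) measurable_const measurable_const)

open Classical in
lemma measurable_recordTime (i : ℕ) : Measurable fun x : ℕ → ℝ => recordTime x i := by
  have key : ∀ k, k ≠ 0 → {x : ℕ → ℝ | recordTime x i = k} =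
      {x | IsLowerRecord x k} ∩ {x | Nat.count (IsLowerRecord x) k = i} := by
    intro k hk
    ext x
    simp only [Set.mem_ofPred_eq, Set.mem_inter_iff, recordTime]
    constructor
    · intro h
      have hlt : ∀ hf : ({j | IsLowerRecord x j} : Set ℕ).Finite, i < hf.toFinset.card := by
        intro hf
        by_contra hc
        exact hk (h ▸ Nat.nth_of_card_le hf (not_lt.mp hc))
      exact ⟨h ▸ Nat.nth_mem i hlt, h ▸ Nat.count_nth hlt⟩
    · rintro ⟨h1, h2⟩
      rw [← h2]
      exact Nat.nth_count h1
  have hne : ∀ k, k ≠ 0 → MeasurableSet {x : ℕ → ℝ | recordTime x i = k} := fun k hk => by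
    rw [key k hk]
    exact (measurableSet_isLowerRecord k).inter
      (measurable_count k (measurableSet_singleton i))
  refine measurable_to_countable' fun k => ?_
  by_cases hk : k = 0
  · have : (fun x : ℕ → ℝ => recordTime x i) ⁻¹' {k} =
        (⋃ l, ⋃ (_ : l ≠ 0), {x : ℕ → ℝ | recordTime x i = l})ᶜ := by
      ext x
      simp only [Set.mem_preimage, Set.mem_singleton_iff, hk, Set.mem_compl_iff, Set.mem_iUnion,
        not_exists]
      constructor
      · intro h l hl h'
        exact hl (h'.symm.trans h)
      · intro h
        by_contra hc
        exact h _ hc rfl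
    rw [this]
    exact (MeasurableSet.iUnion fun l => MeasurableSet.iUnion fun hl => hne l hl).compl
  · exact hne k hk

lemma measurable_recordData (n : ℕ) : Measurable (recordData n) := by
  refine Measurable.prodMk (measurable_pi_lambda _ fun i => ?_) (measurable_pi_lambda _ fun i => ?_)
  · have h : Measurable fun p : (ℕ → ℝ) × ℕ => p.1 p.2 :=
      measurable_from_prod_countable_left fun k => measurable_pi_apply k
    exact h.comp (measurable_id.prodMk (measurable_recordTime i))
  · by_cases hi : i = Fin.last n
    · simp [hi]
    · simp only [hi, if_false]
      exact (measurable_recordTime ((i : ℕ) + 1)).sub (measurable_recordTime i)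

/-! ### The statistical model -/

/-- The law of the record data `(R₁, K₁, …, Rₘ, Kₘ)`, `m = n + 1`, of an i.i.d. sequence drawn from
the Pareto distribution with scale `β` and shape `α`. -/
def recordLaw (n : ℕ) (β α : ℝ) : Measure (RecordData n) :=
  (Measure.infinitePi fun _ : ℕ => paretoMeasure β α).map (recordData n)

/-- The statistic `T₂* = ∑_{i=1}^{m-1} Kᵢ (log Rᵢ - log Rₘ)`, `m = n + 1`. -/
def T2star {n : ℕ} (d : RecordData n) : ℝ :=
  ∑ i : Fin n, (d.2 i.castSucc : ℝ) * (Real.log (d.1 i.castSucc) - Real.log (d.1 (Fin.last n)))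

/-- The chi-square distribution with `v` degrees of freedom. -/
def chiSquare (v : ℕ) : Measure ℝ :=
  gammaMeasure ((v : ℝ) / 2) (1 / 2)

/-- The (lower) `p`-quantile of the chi-square distribution with `v` degrees of freedom. -/
def chiSquareQuantile (v : ℕ) (p : ℝ) : ℝ :=
  sInf {q : ℝ | p ≤ cdf (chiSquare v) q}

/-! ### Tests -/

/-- A (possibly randomized) test: `φ d` is the probability of rejecting the null hypothesis when
`d` is observed. -/
structure IsTest {n : ℕ} (φ : RecordData n → ℝ) : Prop where
  measurable : Measurable φ
  mem_Icc : ∀ d, φ d ∈ Set.Icc (0 : ℝ) 1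

/-- Invariance of a test under the scale changes `Rᵢ ↦ Rᵢ / c`, `0 < c < ∞`. -/
def IsScaleInvariant {n : ℕ} (φ : RecordData n → ℝ) : Prop :=
  ∀ c : ℝ, 0 < c → ∀ d ∈ sampleSpace n, φ (fun i => d.1 i / c, d.2) = φ d

/-- The probability of rejection when the parameter is `θ = (β, α)`. -/
def power {n : ℕ} (φ : RecordData n → ℝ) (θ : ℝ × ℝ) : ℝ :=
  ∫ d, φ d ∂(recordLaw n θ.1 θ.2)

/-- `φ` is a uniformly most powerful scale invariant test of size `γ` of the null hypothesis
`θ ∈ H₀` against the alternative `θ ∈ H₁`: it is a scale invariant test with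
`sup_{θ ∈ H₀} E_θ φ = γ`, and at every `θ ∈ H₁` it is at least as powerful as any scale invariant
test of level `γ`. -/
structure IsUMPInvariantTest {n : ℕ} (H₀ H₁ : Set (ℝ × ℝ)) (γ : ℝ) (φ : RecordData n → ℝ) :
    Prop where
  isTest : IsTest φ
  invariant : IsScaleInvariant φ
  size_eq : IsLUB (power φ '' H₀) γ
  most_powerful : ∀ ψ : RecordData n → ℝ, IsTest ψ → IsScaleInvariant ψ →
    (∀ θ ∈ H₀, power ψ θ ≤ γ) → ∀ θ ∈ H₁, power ψ θ ≤ power φ θ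

end ParetoRecords

end

/-!
The variables `log (Xⱼ / β)` are i.i.d. exponential with rate `α`; let `yᵢ = log (Rᵢ / β)`. Given
the positions of the records, a trial between two records merely must not fall below the current
record (`lintegral_recordTimes`), and almost surely there are infinitely many records; summing
over the positions gives the law of the record data (`lintegral_recordData`), with density
`αᵐ exp (-α ∑ Kᵢ yᵢ)` on `y₁ > ⋯ > yₘ > 0`.

A scale invariant test is a function of `zᵢ = yᵢ - yₘ` and `K`. Since
`∑ Kᵢ yᵢ = T₂* + yₘ ∑ Kᵢ`, integrating out `yₘ` leaves the density `α^(m-1) exp (-α T₂*)` with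
respect to the measure `(∑ Kᵢ)⁻¹ dz`, which does not depend on the parameters (`lintegral_recordLaw`). So
under invariance the scale disappears and the shape indexes a one-parameter exponential family
with statistic `T₂*`.

That these densities have total mass `1` for every `α > 0` already determines the moment generating
function of `2 α T₂*` as `(1 - 2 s)^(-(m-1))`. Hence `2 α T₂*` has a chi-square distribution with
`2 m - 2` degrees of freedom (`map_T2star_invariantLaw`), which gives the size of the tests. The
likelihood ratio of two shapes is monotone in `T₂*`, and optimality is the Neyman–Pearson lemma
(`integral_mul_le_of_likelihood_ratio`) at the boundary shape `α₀`.
-/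

noncomputable section

namespace ParetoRecords

open Set Filter Topology
open scoped ENNReal

/-! ### The law of the record data of an i.i.d. sequence -/

/-- The inter-record numbers of trials of the record times `t`, with last entry `1`. -/
def gaps {n : ℕ} (t : Fin (n + 1) → ℕ) : Fin (n + 1) → ℕ :=
  Fin.snoc (α := fun _ => ℕ) (fun i : Fin n => t i.succ - t i.castSucc) 1

@[simp] lemma gaps_castSucc {n : ℕ} (t : Fin (n + 1) → ℕ) (i : Fin n) :
    gaps t i.castSucc = t i.succ - t i.castSucc := by simp [gaps]

@[simp] lemma gaps_last {n : ℕ} (t : Fin (n + 1) → ℕ) : gaps t (Fin.last n) = 1 := by simp [gaps]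

lemma recordData_of_recordTime_eq {n : ℕ} {x : ℕ → ℝ} {t : Fin (n + 1) → ℕ}
    (h : ∀ i : Fin (n + 1), recordTime x i = t i) :
    recordData n x = (fun i => x (t i), gaps t) := by
  refine Prod.ext (funext fun i => ?_) (funext fun i => ?_)
  · simp [recordData, h i]
  · refine Fin.lastCases ?_ (fun i => ?_) i
    · simp [recordData]
    · have h1 := h i.succ
      have h2 := h i.castSucc
      simp only [Fin.val_succ, Fin.val_castSucc] at h1 h2
      simp [recordData, h1, h2, (Fin.castSucc_lt_last i).ne]

/-- A sequence without a minimum has infinitely many lower records: after any time, the first value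
below the minimum so far is a record. -/
lemma infinite_isLowerRecord {x : ℕ → ℝ} (h : ∀ i, ∃ j, x j < x i) :
    {j | IsLowerRecord x j}.Infinite := by
  refine Set.infinite_of_forall_exists_gt fun N => ?_
  obtain ⟨i₀, -, hmin⟩ := Finset.exists_min_image (Finset.range (N + 1)) x ⟨0, by simp⟩
  classical
  have hex := h i₀
  refine ⟨Nat.find hex, fun l hl => ?_, ?_⟩
  · exact (Nat.find_spec hex).trans_le (not_lt.mp (Nat.find_min hex hl))
  · by_contra hc
    exact (hmin _ (Finset.mem_range.mpr (by omega))).not_gt (Nat.find_spec hex)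

/-- The first `n + 1` record times are `t` exactly when the values at the times `t` decrease and no
value strictly between two consecutive times of `t` falls below the current record. -/
lemma recordTime_eq_iff {n : ℕ} {x : ℕ → ℝ} (hx : {j | IsLowerRecord x j}.Infinite)
    {t : Fin (n + 1) → ℕ} (ht : StrictMono t) (ht0 : t 0 = 0) :
    (∀ i : Fin (n + 1), recordTime x i = t i) ↔
      StrictAnti (fun i => x (t i)) ∧
        ∀ i : Fin n, ∀ j ∈ Finset.Ioo (t i.castSucc) (t i.succ), x (t i.castSucc) ≤ x j := by
  have hmem : ∀ i, IsLowerRecord x (recordTime x i) := fun i => Nat.nth_mem_of_infinite hx i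
  have hmono : StrictMono (recordTime x) := Nat.nth_strictMono hx
  constructor
  · intro h
    have hrec : ∀ i, IsLowerRecord x (t i) := fun i => h i ▸ hmem i
    refine ⟨fun i j hij => hrec j _ (ht hij), fun i j => ?_⟩
    induction j using Nat.strong_induction_on with
    | _ j ih =>
      intro hj
      rw [Finset.mem_Ioo] at hj
      -- a record at `j` would have to be the next record time, but `j < t i.succ`
      have hnot : ¬ IsLowerRecord x j := fun hr => by
        have h1 := h i.succ
        have h2 := h i.castSucc
        simp only [Fin.val_succ, Fin.val_castSucc] at h1 h2
        have := Nat.le_nth_of_lt_nth_succ (p := IsLowerRecord x) (k := i) (a := j)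
          (by change j < recordTime x (i + 1); omega) hr
        change j ≤ recordTime x i at this
        omega
      simp only [IsLowerRecord, not_forall, not_lt] at hnot
      obtain ⟨l, hl, hlj⟩ := hnot
      rcases lt_trichotomy l (t i.castSucc) with h1 | h1 | h1
      · exact (hrec i.castSucc l h1).le.trans hlj
      · exact h1 ▸ hlj
      · exact (ih l hl (Finset.mem_Ioo.mpr ⟨h1, hl.trans hj.2⟩)).trans hlj
  · rintro ⟨hanti, hgap⟩
    have hmin : ∀ i : Fin (n + 1), ∀ l < t i, x (t i) < x l := by
      intro i
      induction i using Fin.induction with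
      | zero => simp [ht0]
      | succ i ih =>
        intro l hl
        have hdec : x (t i.succ) < x (t i.castSucc) := hanti (Fin.castSucc_lt_succ)
        rcases lt_trichotomy l (t i.castSucc) with h1 | h1 | h1
        · exact hdec.trans (ih l h1)
        · exact h1 ▸ hdec
        · exact hdec.trans_le (hgap i l (Finset.mem_Ioo.mpr ⟨h1, hl⟩))
    intro i
    induction i using Fin.induction with
    | zero =>
      rw [ht0]
      exact Nat.nth_zero_of_zero (fun l hl => absurd hl (Nat.not_lt_zero l))
    | succ i ih =>
      simp only [Fin.val_succ, Fin.val_castSucc] at ih ⊢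
      have hlt : t i.castSucc < t i.succ := ht Fin.castSucc_lt_succ
      apply le_antisymm
      · refine (Nat.isLeast_nth_of_infinite hx (i + 1)).2 ⟨hmin i.succ, fun k hk => ?_⟩
        have : recordTime x k ≤ recordTime x i := hmono.monotone (by omega)
        change recordTime x k < _
        omega
      · by_contra hc
        have h1 : recordTime x i < recordTime x (i + 1) := hmono (Nat.lt_succ_self _)
        have h2 := hgap i (recordTime x (i + 1)) (Finset.mem_Ioo.mpr ⟨by omega, by omega⟩)
        exact (hmem (i + 1) (t i.castSucc) (by omega)).not_ge h2

/-- Possible positions of the first `n + 1` lower records. -/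
abbrev RecordTimes (n : ℕ) : Type := {t : Fin (n + 1) → ℕ // StrictMono t ∧ t 0 = 0}

/-- An i.i.d. sequence whose common law has essential infimum `b`, not attained, almost surely has
no minimum, hence infinitely many lower records. -/
lemma ae_infinite_isLowerRecord (μ : Measure ℝ) [IsProbabilityMeasure μ] (b : ℝ)
    (hb : ∀ᵐ a ∂μ, b < a) (hb' : ∀ q, b < q → μ (Iio q) ≠ 0) :
    ∀ᵐ x ∂(Measure.infinitePi fun _ : ℕ => μ), {j | IsLowerRecord x j}.Infinite := by
  have h1 : ∀ᵐ x ∂(Measure.infinitePi fun _ : ℕ => μ), ∀ i, b < x i := by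
    rw [ae_all_iff]
    intro i
    exact (measurePreserving_eval_infinitePi (fun _ : ℕ => μ) i).quasiMeasurePreserving.ae hb
  have h2 : ∀ᵐ x ∂(Measure.infinitePi fun _ : ℕ => μ),
      ∀ k : ℕ, ∃ j, x j < b + 1 / ((k : ℝ) + 1) := by
    rw [ae_all_iff]
    intro k
    set q := b + 1 / ((k : ℝ) + 1) with hq
    have hbq : b < q := by rw [hq]; linarith [Nat.one_div_pos_of_nat (α := ℝ) (n := k)]
    have hlt : μ (Ici q) < 1 := by
      have := prob_compl_eq_one_sub (μ := μ) (measurableSet_Iio (a := q))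
      rw [compl_Iio] at this
      rw [this]
      exact ENNReal.sub_lt_self ENNReal.one_ne_top one_ne_zero (hb' q hbq)
    rw [ae_iff]
    refine le_antisymm (ge_of_tendsto' (ENNReal.tendsto_pow_atTop_nhds_zero_of_lt_one hlt)
      fun N => ?_) zero_le
    have := Measure.infinitePi_pi (fun _ : ℕ => μ) (s := Finset.range N) (t := fun _ => Ici q)
      (fun _ _ => measurableSet_Ici)
    simp only [Finset.prod_const, Finset.card_range] at this
    rw [← this]
    refine measure_mono fun x hx => ?_
    simp only [mem_ofPred_eq, not_exists, not_lt] at hx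
    exact fun i _ => hx i
  filter_upwards [h1, h2] with x hx1 hx2
  refine infinite_isLowerRecord fun i => ?_
  obtain ⟨k, hk⟩ := exists_nat_one_div_lt (sub_pos.mpr (hx1 i))
  obtain ⟨j, hj⟩ := hx2 k
  exact ⟨j, by linarith⟩

lemma measurableSet_strictAnti (m : ℕ) : MeasurableSet {r : Fin m → ℝ | StrictAnti r} := by
  simp only [StrictAnti, ofPred_forall]
  exact MeasurableSet.iInter fun i => MeasurableSet.iInter fun j => MeasurableSet.iInter fun _ =>
    measurableSet_lt (measurable_pi_apply j) (measurable_pi_apply i)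

/-- Contribution of the record times `t` to the law of the record data: given the record values,
the trials between two records are independent and must not fall below the current record. -/
lemma lintegral_recordTimes {n : ℕ} (μ : Measure ℝ) [IsProbabilityMeasure μ] (t : RecordTimes n)
    {g : (Fin (n + 1) → ℝ) → ℝ≥0∞} (hg : Measurable g) :
    ∫⁻ x, {x : ℕ → ℝ | ∀ i : Fin n, ∀ j ∈ Finset.Ioo (t.1 i.castSucc) (t.1 i.succ),
        x (t.1 i.castSucc) ≤ x j}.indicator (fun x => g fun i => x (t.1 i)) x
        ∂(Measure.infinitePi fun _ : ℕ => μ) =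
      ∫⁻ r, g r * ∏ i : Fin n, μ (Ici (r i.castSucc)) ^ (t.1 i.succ - t.1 i.castSucc - 1)
        ∂(Measure.pi fun _ : Fin (n + 1) => μ) := by
  obtain ⟨t, ht, ht0⟩ := t
  dsimp only
  -- `S` indexes the trials that are not records; `e` gives the positions of records and of these
  let S := Σ i : Fin n, {j // j ∈ Finset.Ioo (t i.castSucc) (t i.succ)}
  let e : Fin (n + 1) ⊕ S → ℕ := Sum.elim t (fun s => s.2.1)
  have hS : ∀ s : S, t s.1.castSucc < s.2.1 ∧ s.2.1 < t s.1.succ := fun s =>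
    Finset.mem_Ioo.mp s.2.2
  have hne : ∀ (i : Fin (n + 1)) (s : S), t i ≠ s.2.1 := by
    intro i s h
    obtain ⟨h1, h2⟩ := hS s
    rw [← h] at h1 h2
    have h3 := ht.lt_iff_lt.mp h1
    have h4 := ht.lt_iff_lt.mp h2
    simp only [Fin.lt_def, Fin.val_castSucc, Fin.val_succ] at h3 h4
    omega
  have he : Function.Injective e := by
    rintro (i | s) (i' | s') h
    · exact congrArg _ (ht.injective h)
    · exact absurd h (hne i s')
    · exact absurd h.symm (hne i' s)
    · change s.2.1 = s'.2.1 at h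
      have h1 : s.1 = s'.1 := by
        obtain ⟨h1, h2⟩ := hS s
        obtain ⟨h3, h4⟩ := hS s'
        have h5 := ht.lt_iff_lt.mp (show t s.1.castSucc < t s'.1.succ by omega)
        have h6 := ht.lt_iff_lt.mp (show t s'.1.castSucc < t s.1.succ by omega)
        simp only [Fin.lt_def, Fin.val_castSucc, Fin.val_succ] at h5 h6
        exact Fin.ext (by omega)
      obtain ⟨i, j, hj⟩ := s
      obtain ⟨i', j', hj'⟩ := s'
      obtain rfl : i = i' := h1
      obtain rfl : j = j' := h
      rfl
  have hmap : (Measure.infinitePi fun _ : ℕ => μ).map (fun x i => x (e i)) =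
      Measure.pi fun _ : Fin (n + 1) ⊕ S => μ := by
    rw [Measure.map_infinitePi_infinitePi_of_inj he, Measure.infinitePi_eq_pi]
  have hmp := measurePreserving_sumPiEquivProdPi (fun _ : Fin (n + 1) ⊕ S => μ)
  let A : Set ((Fin (n + 1) → ℝ) × (S → ℝ)) := {p | ∀ s : S, p.1 s.1.castSucc ≤ p.2 s}
  have hA : MeasurableSet A := by
    simp only [A, ofPred_forall]
    exact MeasurableSet.iInter fun s => measurableSet_le (by fun_prop) (by fun_prop)
  let G : (Fin (n + 1) → ℝ) × (S → ℝ) → ℝ≥0∞ := A.indicator fun p => g p.1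
  have hG : Measurable G := (hg.comp measurable_fst).indicator hA
  have hlhs : ∀ x : ℕ → ℝ, {x : ℕ → ℝ | ∀ i : Fin n, ∀ j ∈ Finset.Ioo (t i.castSucc) (t i.succ),
        x (t i.castSucc) ≤ x j}.indicator (fun x => g fun i => x (t i)) x =
      G (MeasurableEquiv.sumPiEquivProdPi (fun _ : Fin (n + 1) ⊕ S => ℝ) fun i => x (e i)) := by
    intro x
    classical
    simp only [G, indicator_apply]
    refine if_congr ?_ rfl rfl
    exact ⟨fun h s => h s.1 s.2.1 s.2.2, fun h i j hj => h ⟨i, j, hj⟩⟩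
  simp_rw [hlhs]
  have hmeas : Measurable fun x : ℕ → ℝ => fun i : Fin (n + 1) ⊕ S => x (e i) := by fun_prop
  rw [← lintegral_map (f := fun y => G (MeasurableEquiv.sumPiEquivProdPi
      (fun _ : Fin (n + 1) ⊕ S => ℝ) y)) (hG.comp (MeasurableEquiv.measurable _)) hmeas, hmap,
    hmp.lintegral_comp hG, lintegral_prod _ hG.aemeasurable]
  refine lintegral_congr fun r => ?_
  have hbox : ∀ w : S → ℝ, G (r, w) =
      (univ.pi fun s : S => Ici (r s.1.castSucc)).indicator (fun _ => g r) w := by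
    intro w
    classical
    simp only [G, indicator_apply]
    refine if_congr ?_ rfl rfl
    simp [A, Pi.le_def]
  simp_rw [hbox]
  rw [lintegral_indicator_const (MeasurableSet.univ_pi fun _ => measurableSet_Ici), Measure.pi_pi,
    Fintype.prod_sigma]
  simp

/-- The law of the record data of an i.i.d. sequence with infinitely many lower records. -/
theorem lintegral_recordData {n : ℕ} (μ : Measure ℝ) [IsProbabilityMeasure μ]
    (hμ : ∀ᵐ x ∂(Measure.infinitePi fun _ : ℕ => μ), {j | IsLowerRecord x j}.Infinite)
    {f : RecordData n → ℝ≥0∞} (hf : Measurable f) :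
    ∫⁻ x, f (recordData n x) ∂(Measure.infinitePi fun _ : ℕ => μ) =
      ∑' t : RecordTimes n, ∫⁻ r, {r : Fin (n + 1) → ℝ | StrictAnti r}.indicator
        (fun r => f (r, gaps t.1)) r *
          ∏ i : Fin n, μ (Ici (r i.castSucc)) ^ (t.1 i.succ - t.1 i.castSucc - 1)
        ∂(Measure.pi fun _ : Fin (n + 1) => μ) := by
  have hE : ∀ t : RecordTimes n,
      MeasurableSet {x : ℕ → ℝ | ∀ i : Fin (n + 1), recordTime x i = t.1 i} := fun t => by
    simp only [ofPred_forall]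
    exact MeasurableSet.iInter fun i => measurable_recordTime i (measurableSet_singleton _)
  have hsplit : ∀ᵐ x ∂(Measure.infinitePi fun _ : ℕ => μ), f (recordData n x) =
      ∑' t : RecordTimes n, {x : ℕ → ℝ | ∀ i : Fin (n + 1), recordTime x i = t.1 i}.indicator
        (fun x => f (recordData n x)) x := by
    filter_upwards [hμ] with x hx
    let t₀ : RecordTimes n := ⟨fun i => recordTime x i,
      fun i j hij => Nat.nth_strictMono hx hij,
      Nat.nth_zero_of_zero (fun l hl => absurd hl (Nat.not_lt_zero l))⟩
    rw [tsum_eq_single t₀]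
    · rw [indicator_of_mem (by intro i; rfl)]
    · intro t ht
      refine indicator_of_notMem (fun h => ht ?_) _
      exact Subtype.ext (funext fun i => (h i).symm)
  have hfr : Measurable fun x : ℕ → ℝ => f (recordData n x) := hf.comp (measurable_recordData n)
  rw [lintegral_congr_ae hsplit, lintegral_tsum fun t =>
    (hfr.indicator (hE t)).aemeasurable]
  refine tsum_congr fun t => ?_
  have hft : Measurable fun r : Fin (n + 1) → ℝ => f (r, gaps t.1) := hf.comp (by fun_prop)
  rw [← lintegral_recordTimes μ t (hft.indicator (measurableSet_strictAnti _))]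
  refine lintegral_congr_ae ?_
  filter_upwards [hμ] with x hx
  have hiff := recordTime_eq_iff hx t.2.1 t.2.2
  classical
  simp only [indicator_apply, mem_ofPred_eq]
  by_cases h : ∀ i : Fin (n + 1), recordTime x i = t.1 i
  · rw [if_pos h, if_pos (hiff.mp h).2, if_pos (hiff.mp h).1, recordData_of_recordTime_eq h]
  · rw [if_neg h]
    by_cases h2 : ∀ i : Fin n, ∀ j ∈ Finset.Ioo (t.1 i.castSucc) (t.1 i.succ),
        x (t.1 i.castSucc) ≤ x j
    · rw [if_pos h2, if_neg fun h3 => h (hiff.mpr ⟨h3, h2⟩)]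
    · rw [if_neg h2]

/-! ### The Pareto model in logarithmic coordinates -/

lemma lintegral_exp_neg_mul_Ioi {a : ℝ} (ha : 0 < a) (c : ℝ) :
    ∫⁻ u in Ioi c, ENNReal.ofReal (Real.exp (-(a * u))) =
      ENNReal.ofReal (Real.exp (-(a * c)) / a) := by
  have h := integral_exp_mul_Ioi (a := -a) (by linarith) c
  have hi : IntegrableOn (fun x => Real.exp (-a * x)) (Ioi c) := by
    have := integrableOn_exp_mul_Ioi (a := -a) (by linarith) c
    exact this
  simp only [neg_mul] at h hi
  rw [← ofReal_integral_eq_lintegral_ofReal hi (ae_of_all _ fun u => (Real.exp_pos _).le), h]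
  congr 1
  field_simp

instance nullSingletonClass_gammaMeasure (a r : ℝ) : NullSingletonClass (gammaMeasure a r) :=
  inferInstanceAs (NullSingletonClass (volume.withDensity (gammaPDF a r)))

/-- The survival function of the exponential distribution. -/
lemma expMeasure_Ici {α : ℝ} (hα : 0 < α) {y : ℝ} (hy : 0 ≤ y) :
    expMeasure α (Ici y) = ENNReal.ofReal (Real.exp (-(α * y))) := by
  change volume.withDensity (exponentialPDF α) (Ici y) = _
  rw [withDensity_apply _ measurableSet_Ici, setLIntegral_congr Ioi_ae_eq_Ici.symm,
    setLIntegral_congr_fun (g := fun u => ENNReal.ofReal α * ENNReal.ofReal (Real.exp (-(α * u))))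
      measurableSet_Ioi, lintegral_const_mul _ (by fun_prop), lintegral_exp_neg_mul_Ioi hα,
    ← ENNReal.ofReal_mul hα.le]
  · congr 1
    field_simp
  · intro u hu
    dsimp only
    rw [exponentialPDF_of_nonneg (hy.trans (le_of_lt hu)), ENNReal.ofReal_mul hα.le]

/-- If `Y` is exponential with rate `α`, then `β * exp Y` is Pareto with scale `β`, shape `α`. -/
lemma paretoMeasure_eq_map_expMeasure {β α : ℝ} (hβ : 0 < β) (hα : 0 < α) :
    paretoMeasure β α = (expMeasure α).map (fun y => β * Real.exp y) := by
  have hm : Measurable fun y : ℝ => β * Real.exp y := by fun_prop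
  have himg : (fun y : ℝ => β * Real.exp y) '' Ioi 0 = Ioi β := by
    ext x
    simp only [mem_image, mem_Ioi]
    constructor
    · rintro ⟨y, hy, rfl⟩
      nlinarith [Real.one_lt_exp_iff.mpr hy]
    · intro hx
      have hx0 : 0 < x / β := div_pos (hβ.trans hx) hβ
      refine ⟨Real.log (x / β), Real.log_pos ((one_lt_div hβ).mpr hx), ?_⟩
      rw [Real.exp_log hx0]
      field_simp
  have hinj : InjOn (fun y : ℝ => β * Real.exp y) (Ioi 0) := fun a _ b _ h =>
    Real.exp_injective (mul_left_cancel₀ hβ.ne' h)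
  ext s hs
  rw [Measure.map_apply hm hs]
  change volume.withDensity (paretoPDF β α) s = volume.withDensity (exponentialPDF α) _
  rw [withDensity_apply _ hs, withDensity_apply _ (hm hs), ← lintegral_indicator hs,
    ← lintegral_indicator (hm hs)]
  have h1 : ∀ (b : ℝ) (g : ℝ → ℝ≥0∞), (∀ x < b, g x = 0) → ∫⁻ x, g x = ∫⁻ x in Ioi b, g x := by
    intro b g hg
    rw [← setLIntegral_congr (Ioi_ae_eq_Ici (a := b)).symm, ← lintegral_indicator measurableSet_Ici]
    refine lintegral_congr fun x => ?_
    by_cases hx : b ≤ x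
    · rw [indicator_of_mem (mem_Ici.mpr hx)]
    · rw [indicator_of_notMem (mt mem_Ici.mp hx), hg x (not_le.mp hx)]
  rw [h1 β _ fun x hx => indicator_apply_eq_zero.mpr fun _ => paretoPDF_of_lt hx,
    h1 0 _ fun x hx => indicator_apply_eq_zero.mpr fun _ => exponentialPDF_of_neg hx, ← himg,
    lintegral_image_eq_lintegral_abs_deriv_mul (f' := fun y => β * Real.exp y) measurableSet_Ioi
      (fun y _ => ((Real.hasDerivAt_exp y).const_mul β).hasDerivWithinAt) hinj]
  refine setLIntegral_congr_fun measurableSet_Ioi fun y hy => ?_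
  have hy' : 0 < y := hy
  have hpos : 0 < β * Real.exp y := by positivity
  have hle : β ≤ β * Real.exp y := le_mul_of_one_le_right hβ.le (Real.one_le_exp hy'.le)
  by_cases hys : β * Real.exp y ∈ s
  · rw [indicator_of_mem hys,
      indicator_of_mem (show y ∈ (fun y => β * Real.exp y) ⁻¹' s from hys), paretoPDF_of_le hle,
      exponentialPDF_of_nonneg hy'.le, ← ENNReal.ofReal_mul (abs_nonneg _), abs_of_pos hpos,
      Real.mul_rpow hβ.le (Real.exp_pos y).le, ← Real.exp_mul, neg_add, mul_add,
      Real.exp_add, Real.rpow_add hβ, Real.rpow_neg hβ.le, Real.rpow_neg_one, mul_neg_one,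
      Real.exp_neg y]
    congr 1
    have hβα : β ^ α ≠ 0 := (Real.rpow_pos_of_pos hβ α).ne'
    field_simp
  · rw [indicator_of_notMem hys,
      indicator_of_notMem (show y ∉ (fun y => β * Real.exp y) ⁻¹' s from hys), mul_zero]

lemma paretoMeasure_Ici {β α : ℝ} (hβ : 0 < β) (hα : 0 < α) {y : ℝ} (hy : 0 ≤ y) :
    paretoMeasure β α (Ici (β * Real.exp y)) = ENNReal.ofReal (Real.exp (-(α * y))) := by
  rw [paretoMeasure_eq_map_expMeasure hβ hα, Measure.map_apply (by fun_prop) measurableSet_Ici,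
    ← expMeasure_Ici hα hy]
  congr 1
  ext x
  simp [hβ]

lemma ae_infinite_isLowerRecord_pareto {β α : ℝ} (hβ : 0 < β) (hα : 0 < α) :
    ∀ᵐ x ∂(Measure.infinitePi fun _ : ℕ => paretoMeasure β α),
      {j | IsLowerRecord x j}.Infinite := by
  have := isProbabilityMeasure_paretoMeasure hβ hα
  have hexp := isProbabilityMeasure_expMeasure hα
  refine ae_infinite_isLowerRecord _ β ?_ fun q hq h => ?_
  · have h0 : expMeasure α (Iic 0) = 0 := by
      rw [← ofReal_cdf, cdf_expMeasure_eq hα]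
      simp
    rw [ae_iff, paretoMeasure_eq_map_expMeasure hβ hα, Measure.map_apply (by fun_prop)
      (by simp only [not_lt]; exact measurableSet_Iic), ← h0]
    congr 1
    ext y
    simp [hβ]
  · have hlog : 0 < Real.log (q / β) := Real.log_pos ((one_lt_div hβ).mpr hq)
    have h1 := paretoMeasure_Ici hβ hα hlog.le
    rw [Real.exp_log (div_pos (hβ.trans hq) hβ), mul_div_cancel₀ _ hβ.ne', ← compl_Iio,
      prob_compl_eq_one_sub measurableSet_Iio, h, tsub_zero, eq_comm, ENNReal.ofReal_eq_one,
      Real.exp_eq_one_iff] at h1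
    nlinarith

/-- Tonelli's theorem for a product of functions of the single coordinates. -/
lemma lintegral_fin_prod_eq_prod {m : ℕ} (μ : Fin m → Measure ℝ) [∀ i, SigmaFinite (μ i)]
    {p : Fin m → ℝ → ℝ≥0∞} (hp : ∀ i, Measurable (p i)) :
    ∫⁻ y, ∏ i, p i (y i) ∂(Measure.pi μ) = ∏ i, ∫⁻ x, p i x ∂(μ i) := by
  induction m with
  | zero => simp
  | succ m ih =>
    have hmp := (measurePreserving_piFinSuccAbove μ 0).symm
    have hmeas : Measurable fun y : Fin (m + 1) → ℝ => ∏ i, p i (y i) :=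
      Finset.measurable_prod _ fun i _ => (hp i).comp (measurable_pi_apply i)
    have hmeas' : Measurable fun y : Fin m → ℝ => ∏ i : Fin m, p i.succ (y i) :=
      Finset.measurable_prod _ fun i _ => (hp i.succ).comp (measurable_pi_apply i)
    rw [← hmp.lintegral_comp hmeas, Fin.prod_univ_succ, ← ih (fun i => μ i.succ) fun i => hp i.succ,
      ← lintegral_prod_mul (hp 0).aemeasurable hmeas'.aemeasurable]
    refine lintegral_congr fun y => ?_
    simp [Fin.prod_univ_succ, MeasurableEquiv.piFinSuccAbove_symm_apply, Fin.insertNthEquiv]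

/-- A product of measures with densities has the product density. -/
lemma pi_withDensity {m : ℕ} (μ : Measure ℝ) [SigmaFinite μ] {p : ℝ → ℝ≥0∞} (hp : Measurable p)
    [SigmaFinite (μ.withDensity p)] :
    (Measure.pi fun _ : Fin m => μ.withDensity p) =
      (Measure.pi fun _ : Fin m => μ).withDensity fun y => ∏ i, p (y i) := by
  refine Measure.pi_eq fun s hs => ?_
  rw [withDensity_apply _ (MeasurableSet.univ_pi hs), ← lintegral_indicator
    (MeasurableSet.univ_pi hs)]
  simp_rw [withDensity_apply _ (hs _), ← lintegral_indicator (hs _)]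
  rw [← lintegral_fin_prod_eq_prod (fun _ => μ) fun i => hp.indicator (hs i)]
  refine lintegral_congr fun y => ?_
  by_cases hy : y ∈ univ.pi s
  · rw [indicator_of_mem hy]
    exact Finset.prod_congr rfl fun i _ => (indicator_of_mem (hy i (mem_univ i)) _).symm
  · rw [indicator_of_notMem hy]
    simp only [mem_univ_pi, not_forall] at hy
    obtain ⟨i, hi⟩ := hy
    exact (Finset.prod_eq_zero (Finset.mem_univ i) (indicator_of_notMem hi _)).symm

lemma lintegral_pi_paretoMeasure {m : ℕ} {β α : ℝ} (hβ : 0 < β) (hα : 0 < α)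
    {g : (Fin m → ℝ) → ℝ≥0∞} (hg : Measurable g) :
    ∫⁻ r, g r ∂(Measure.pi fun _ : Fin m => paretoMeasure β α) =
      ∫⁻ y : Fin m → ℝ, (∏ i, exponentialPDF α (y i)) * g fun i => β * Real.exp (y i) := by
  have hexp := isProbabilityMeasure_expMeasure hα
  have hpdf : Measurable (exponentialPDF α) := (measurable_exponentialPDFReal α).ennreal_ofReal
  have hβm : Measurable fun y : ℝ => β * Real.exp y := by fun_prop
  have hpr : IsProbabilityMeasure ((expMeasure α).map fun y => β * Real.exp y) :=
    Measure.isProbabilityMeasure_map hβm.aemeasurable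
  have hsf : SigmaFinite (volume.withDensity (exponentialPDF α)) :=
    inferInstanceAs (SigmaFinite (expMeasure α))
  simp_rw [paretoMeasure_eq_map_expMeasure hβ hα]
  rw [← Measure.pi_map_pi fun _ => hβm.aemeasurable, lintegral_map hg (by fun_prop)]
  change ∫⁻ y, _ ∂(Measure.pi fun _ => volume.withDensity (exponentialPDF α)) = _
  have hprod : Measurable fun y : Fin m → ℝ => ∏ i, exponentialPDF α (y i) :=
    Finset.measurable_prod _ fun i _ => hpdf.comp (measurable_pi_apply i)
  have hgm : Measurable fun y : Fin m → ℝ => g fun i => β * Real.exp (y i) :=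
    hg.comp (by fun_prop)
  rw [pi_withDensity volume hpdf, lintegral_withDensity_eq_lintegral_mul _ hprod hgm]
  rfl

/-- Lebesgue measure in the coordinates given by the last entry `u` and the differences of the
other entries from `u`. -/
lemma lintegral_snoc_add {n : ℕ} {g : (Fin (n + 1) → ℝ) → ℝ≥0∞} (hg : Measurable g) :
    ∫⁻ y, g y = ∫⁻ u : ℝ, ∫⁻ z : Fin n → ℝ,
      g fun i => Fin.snoc (α := fun _ => ℝ) z 0 i + u := by
  have hmp := (volume_preserving_piFinSuccAbove (fun _ : Fin (n + 1) => ℝ) (Fin.last n)).symm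
  have hgm : Measurable fun p : ℝ × (Fin n → ℝ) =>
      g ((MeasurableEquiv.piFinSuccAbove (fun _ => ℝ) (Fin.last n)).symm p) :=
    hg.comp (MeasurableEquiv.measurable _)
  rw [← hmp.lintegral_comp hg, Measure.volume_eq_prod, lintegral_prod _ hgm.aemeasurable]
  refine lintegral_congr fun u => ?_
  -- for fixed last entry `u`, translate the other entries by `u`
  rw [← lintegral_add_right_eq_self _ fun _ : Fin n => u]
  refine lintegral_congr fun z => congrArg g (funext fun i => ?_)
  refine Fin.lastCases ?_ (fun i => ?_) i
  · simp [MeasurableEquiv.piFinSuccAbove_symm_apply, Fin.insertNthEquiv]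
  · simp [MeasurableEquiv.piFinSuccAbove_symm_apply, Fin.insertNthEquiv]

/-! ### Reduction by scale invariance -/

/-- The record data, rescaled to have last record value `1`, in terms of the record times `t` and
the log-ratios `z i = log (Rᵢ / Rₘ)`. -/
def normalizedData {n : ℕ} (t : Fin (n + 1) → ℕ) (z : Fin n → ℝ) : RecordData n :=
  (fun i => Real.exp (Fin.snoc (α := fun _ => ℝ) z 0 i), gaps t)

/-- The sum `K₁ + … + Kₘ`, where `Kₘ = 1`, as a real number. -/
def numTrials {n : ℕ} (t : Fin (n + 1) → ℕ) : ℝ :=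
  ∑ i : Fin n, (gaps t i.castSucc : ℝ) + 1

/-- The possible log-ratios of record data: positive and strictly decreasing vectors. -/
def logRatioDomain (n : ℕ) : Set (Fin n → ℝ) :=
  {z | StrictAnti (Fin.snoc (α := fun _ => ℝ) z 0 : Fin (n + 1) → ℝ)}

/-- The measure on normalized record data that dominates the laws of the maximal invariant
`(R / Rₘ, K)`. The factor `1 / ∑ Kᵢ` comes from integrating out the last record value. -/
def invariantMeasure (n : ℕ) : Measure (RecordData n) :=
  Measure.sum fun t : RecordTimes n => ENNReal.ofReal (numTrials t.1)⁻¹ •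
    (volume.restrict (logRatioDomain n)).map (normalizedData t.1)

lemma numTrials_pos {n : ℕ} (t : Fin (n + 1) → ℕ) : 0 < numTrials t := by
  unfold numTrials; positivity

lemma measurable_snoc_zero (n : ℕ) :
    Measurable fun z : Fin n → ℝ => (Fin.snoc (α := fun _ => ℝ) z 0 : Fin (n + 1) → ℝ) := by
  refine measurable_pi_lambda _ fun i => ?_
  refine Fin.lastCases ?_ (fun i => ?_) i
  · simp
  · simpa using measurable_pi_apply i

lemma measurable_normalizedData {n : ℕ} (t : Fin (n + 1) → ℕ) : Measurable (normalizedData t) := by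
  refine Measurable.prodMk (measurable_pi_lambda _ fun i => ?_) measurable_const
  exact Real.measurable_exp.comp ((measurable_pi_apply i).comp (measurable_snoc_zero n))

lemma measurableSet_logRatioDomain (n : ℕ) : MeasurableSet (logRatioDomain n) :=
  measurable_snoc_zero n (measurableSet_strictAnti (n + 1))

lemma measurable_T2star (n : ℕ) : Measurable (T2star : RecordData n → ℝ) := by
  refine Finset.measurable_sum _ fun i _ => Measurable.mul ?_ ?_
  · exact measurable_from_top.comp ((measurable_pi_apply i.castSucc).comp measurable_snd)
  · exact (Real.measurable_log.comp ((measurable_pi_apply _).comp measurable_fst)).sub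
      (Real.measurable_log.comp ((measurable_pi_apply _).comp measurable_fst))

lemma T2star_normalizedData {n : ℕ} (t : Fin (n + 1) → ℕ) (z : Fin n → ℝ) :
    T2star (normalizedData t z) = ∑ i : Fin n, (gaps t i.castSucc : ℝ) * z i := by
  simp [T2star, normalizedData]

lemma one_le_gaps {n : ℕ} {t : Fin (n + 1) → ℕ} (ht : StrictMono t) (i : Fin (n + 1)) :
    1 ≤ gaps t i := by
  refine Fin.lastCases ?_ (fun i => ?_) i
  · simp
  · have := ht (Fin.castSucc_lt_succ (i := i))
    rw [gaps_castSucc]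
    omega

lemma lintegral_invariantMeasure {n : ℕ} {f : RecordData n → ℝ≥0∞} (hf : Measurable f) :
    ∫⁻ d, f d ∂(invariantMeasure n) = ∑' t : RecordTimes n,
      ENNReal.ofReal (numTrials t.1)⁻¹ * ∫⁻ z in logRatioDomain n, f (normalizedData t.1 z) := by
  rw [invariantMeasure, lintegral_sum_measure]
  refine tsum_congr fun t => ?_
  rw [lintegral_smul_measure, lintegral_map hf (measurable_normalizedData t.1), smul_eq_mul]

/-- In the coordinates `u = log (Rₘ / β)` and `z i = log (Rᵢ / Rₘ)` the density of the record data
separates, since `∑ Kᵢ (zᵢ + u) = T₂* + u ∑ Kᵢ`. -/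
lemma density_identity {n : ℕ} (α : ℝ) {t : Fin (n + 1) → ℕ} (ht : StrictMono t)
    (z : Fin n → ℝ) (u : ℝ) :
    (∏ i : Fin (n + 1), α * Real.exp (-(α * (Fin.snoc (α := fun _ => ℝ) z 0 i + u)))) *
        ∏ i : Fin n, Real.exp (-(α * (z i + u))) ^ (t i.succ - t i.castSucc - 1) =
      α ^ n * Real.exp (-(α * T2star (normalizedData t z))) *
        (α * Real.exp (-(α * numTrials t * u))) := by
  have hfac : ∀ i : Fin n, α * Real.exp (-(α * (z i + u))) *
      Real.exp (-(α * (z i + u))) ^ (t i.succ - t i.castSucc - 1) =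
      α * Real.exp (-(α * ((gaps t i.castSucc : ℝ) * (z i + u)))) := by
    intro i
    have h1 : t i.succ - t i.castSucc - 1 + 1 = gaps t i.castSucc := by
      have := one_le_gaps ht i.castSucc
      rw [gaps_castSucc] at this ⊢
      omega
    rw [mul_assoc, ← pow_succ', h1, ← Real.exp_nat_mul]
    congr 2
    ring
  rw [Fin.prod_univ_castSucc]
  simp only [Fin.snoc_castSucc, Fin.snoc_last, zero_add]
  rw [mul_right_comm, ← Finset.prod_mul_distrib, Finset.prod_congr rfl fun i _ => hfac i,
    Finset.prod_mul_distrib, ← Real.exp_sum, T2star_normalizedData]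
  simp only [Finset.prod_const, Finset.card_univ, Fintype.card_fin]
  have hsum : ∑ i : Fin n, -(α * ((gaps t i.castSucc : ℝ) * (z i + u))) + -(α * u) =
      -(α * ∑ i : Fin n, (gaps t i.castSucc : ℝ) * z i) + -(α * numTrials t * u) := by
    rw [numTrials, Finset.sum_neg_distrib, ← Finset.mul_sum]
    simp only [mul_add, Finset.sum_add_distrib, ← Finset.sum_mul]
    ring
  have hexp := congrArg Real.exp hsum
  rw [Real.exp_add, Real.exp_add] at hexp
  linear_combination (α ^ n * α) * hexp

/-- The density of the record data times a scale invariant function, in the coordinates `z` and `u`,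
is a function of `z` times a function of `u`. The case `u = 0` is excluded because
`exponentialPDF α 0 = α`. -/
lemma density_eq_mul_of_invariant {n : ℕ} {β α : ℝ} (hβ : 0 < β) (hα : 0 < α)
    {f : RecordData n → ℝ≥0∞}
    (hinv : ∀ c : ℝ, 0 < c → ∀ d ∈ sampleSpace n, f (fun i => d.1 i / c, d.2) = f d)
    (t : RecordTimes n) (z : Fin n → ℝ) {u : ℝ} (hu : u ≠ 0) :
    (∏ i, exponentialPDF α (Fin.snoc (α := fun _ => ℝ) z 0 i + u)) *
        ({r : Fin (n + 1) → ℝ | StrictAnti r}.indicator (fun r => f (r, gaps t.1))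
          (fun i => β * Real.exp (Fin.snoc (α := fun _ => ℝ) z 0 i + u)) *
        ∏ i : Fin n, paretoMeasure β α
          (Ici (β * Real.exp (Fin.snoc (α := fun _ => ℝ) z 0 i.castSucc + u))) ^
            (t.1 i.succ - t.1 i.castSucc - 1)) =
      (logRatioDomain n).indicator (fun z => f (normalizedData t.1 z) *
          ENNReal.ofReal (α ^ n * Real.exp (-(α * T2star (normalizedData t.1 z))))) z *
        (Ioi (0 : ℝ)).indicator
          (fun u => ENNReal.ofReal (α * Real.exp (-(α * numTrials t.1 * u)))) u := by
  rcases lt_or_gt_of_ne hu with hneg | hpos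
  · rw [indicator_of_notMem (s := Ioi (0 : ℝ)) (by simpa using hneg.le), mul_zero,
      Fin.prod_univ_castSucc, Fin.snoc_last, zero_add, exponentialPDF_of_neg hneg, mul_zero,
      zero_mul]
  rw [indicator_of_mem (s := Ioi (0 : ℝ)) hpos]
  have hiff : StrictAnti (fun i => β * Real.exp (Fin.snoc (α := fun _ => ℝ) z 0 i + u)) ↔
      z ∈ logRatioDomain n := by
    simp only [logRatioDomain, StrictAnti, mem_ofPred_eq]
    refine forall_congr' fun i => forall_congr' fun j => imp_congr_right fun _ => ?_
    rw [mul_lt_mul_iff_right₀ hβ, Real.exp_lt_exp, add_lt_add_iff_right]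
  by_cases hz : z ∈ logRatioDomain n
  · have hz0 : ∀ i, 0 ≤ Fin.snoc (α := fun _ => ℝ) z 0 i := fun i => by
      have := StrictAnti.antitone hz (Fin.le_last i)
      rwa [Fin.snoc_last] at this
    have hmem : ((fun i => β * Real.exp (Fin.snoc (α := fun _ => ℝ) z 0 i + u), gaps t.1) :
        RecordData n) ∈ sampleSpace n :=
      ⟨fun i => by positivity, hiff.mpr hz, one_le_gaps t.2.1, gaps_last t.1⟩
    have hfz : f (fun i => β * Real.exp (Fin.snoc (α := fun _ => ℝ) z 0 i + u), gaps t.1) =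
        f (normalizedData t.1 z) := by
      -- dividing by the last record value `β * exp u` normalizes the data
      rw [← hinv (β * Real.exp u) (by positivity) _ hmem]
      congr 1
      refine Prod.ext (funext fun i => ?_) rfl
      simp only [normalizedData, Real.exp_add]
      have := Real.exp_pos u
      field_simp
    rw [indicator_of_mem hz, indicator_of_mem (show _ ∈ {r | StrictAnti r} from hiff.mpr hz), hfz]
    have h1 : ∀ i, exponentialPDF α (Fin.snoc (α := fun _ => ℝ) z 0 i + u) =
        ENNReal.ofReal (α * Real.exp (-(α * (Fin.snoc (α := fun _ => ℝ) z 0 i + u)))) := fun i =>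
      exponentialPDF_of_nonneg (add_nonneg (hz0 i) hpos.le)
    have h2 : ∀ i : Fin n, paretoMeasure β α
          (Ici (β * Real.exp (Fin.snoc (α := fun _ => ℝ) z 0 i.castSucc + u))) ^
            (t.1 i.succ - t.1 i.castSucc - 1) =
        ENNReal.ofReal (Real.exp (-(α * (z i + u))) ^ (t.1 i.succ - t.1 i.castSucc - 1)) := by
      intro i
      rw [paretoMeasure_Ici hβ hα (add_nonneg (hz0 _) hpos.le),
        ENNReal.ofReal_pow (Real.exp_pos _).le, Fin.snoc_castSucc]
    simp_rw [h1, h2]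
    rw [← ENNReal.ofReal_prod_of_nonneg fun i _ => by positivity,
      ← ENNReal.ofReal_prod_of_nonneg fun i _ => by positivity, mul_left_comm,
      ← ENNReal.ofReal_mul (Finset.prod_nonneg fun i _ => by positivity),
      density_identity α t.2.1, ENNReal.ofReal_mul (by positivity), ← mul_assoc]
  · rw [indicator_of_notMem hz, indicator_of_notMem (show _ ∉ {r | StrictAnti r} from
      fun h => hz (hiff.mp h))]
    simp

/-- For scale invariant functions of the record data the scale `β` is immaterial, and the laws for
varying shape `α` form an exponential family with sufficient statistic `T₂*`. -/
theorem lintegral_recordLaw {n : ℕ} {β α : ℝ} (hβ : 0 < β) (hα : 0 < α)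
    {f : RecordData n → ℝ≥0∞} (hf : Measurable f)
    (hinv : ∀ c : ℝ, 0 < c → ∀ d ∈ sampleSpace n, f (fun i => d.1 i / c, d.2) = f d) :
    ∫⁻ d, f d ∂(recordLaw n β α) =
      ∫⁻ d, f d * ENNReal.ofReal (α ^ n * Real.exp (-(α * T2star d))) ∂(invariantMeasure n) := by
  have hpr := isProbabilityMeasure_paretoMeasure hβ hα
  have hT := measurable_T2star n
  have hfT : Measurable fun d : RecordData n =>
      f d * ENNReal.ofReal (α ^ n * Real.exp (-(α * T2star d))) := by fun_prop
  rw [recordLaw, lintegral_map hf (measurable_recordData n),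
    lintegral_recordData _ (ae_infinite_isLowerRecord_pareto hβ hα) hf,
    lintegral_invariantMeasure hfT]
  refine tsum_congr fun t => ?_
  have hIci : Measurable fun r : ℝ => paretoMeasure β α (Ici r) :=
    Antitone.measurable fun a b hab => measure_mono (Ici_subset_Ici.mpr hab)
  have hft : Measurable fun r : Fin (n + 1) → ℝ => f (r, gaps t.1) := hf.comp (by fun_prop)
  have hg : Measurable fun r : Fin (n + 1) → ℝ => {r : Fin (n + 1) → ℝ | StrictAnti r}.indicator
      (fun r => f (r, gaps t.1)) r * ∏ i : Fin n, paretoMeasure β α (Ici (r i.castSucc)) ^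
        (t.1 i.succ - t.1 i.castSucc - 1) :=
    (hft.indicator (measurableSet_strictAnti _)).mul (Finset.measurable_prod _ fun i _ =>
      (hIci.comp (measurable_pi_apply _)).pow_const _)
  have hpdf : Measurable (exponentialPDF α) := (measurable_exponentialPDFReal α).ennreal_ofReal
  have hprod : Measurable fun y : Fin (n + 1) → ℝ => ∏ i, exponentialPDF α (y i) :=
    Finset.measurable_prod _ fun i _ => hpdf.comp (measurable_pi_apply i)
  have hexp : Measurable fun (y : Fin (n + 1) → ℝ) i => β * Real.exp (y i) := by fun_prop
  rw [lintegral_pi_paretoMeasure hβ hα hg]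
  refine (lintegral_snoc_add (hprod.mul (hg.comp hexp))).trans ?_
  have hz : Measurable fun z : Fin n → ℝ => f (normalizedData t.1 z) *
      ENNReal.ofReal (α ^ n * Real.exp (-(α * T2star (normalizedData t.1 z)))) :=
    hfT.comp (measurable_normalizedData t.1)
  have hne : ∀ᵐ u : ℝ, u ≠ 0 := by simp [ae_iff]
  have hN := numTrials_pos t.1
  calc _ = ∫⁻ u : ℝ, (∫⁻ z : Fin n → ℝ, (logRatioDomain n).indicator
          (fun z => f (normalizedData t.1 z) *
            ENNReal.ofReal (α ^ n * Real.exp (-(α * T2star (normalizedData t.1 z))))) z) *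
        (Ioi (0 : ℝ)).indicator
          (fun u => ENNReal.ofReal (α * Real.exp (-(α * numTrials t.1 * u)))) u := by
        refine lintegral_congr_ae ?_
        filter_upwards [hne] with u hu
        rw [← lintegral_mul_const _ (hz.indicator (measurableSet_logRatioDomain n))]
        exact lintegral_congr fun z => density_eq_mul_of_invariant hβ hα hinv t z hu
    _ = _ := by
        rw [lintegral_const_mul _ (Measurable.indicator (by fun_prop) measurableSet_Ioi),
          lintegral_indicator (measurableSet_logRatioDomain n), lintegral_indicator
          measurableSet_Ioi, mul_comm]
        congr 1
        simp_rw [ENNReal.ofReal_mul hα.le]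
        rw [lintegral_const_mul _ (by fun_prop), lintegral_exp_neg_mul_Ioi (mul_pos hα hN),
          ← ENNReal.ofReal_mul hα.le]
        congr 1
        simp
        field_simp

/-- The density, with respect to `invariantMeasure n`, of the normalized record data for the
shape `α`. -/
def invariantPDF (n : ℕ) (α : ℝ) (d : RecordData n) : ℝ :=
  α ^ n * Real.exp (-(α * T2star d))

/-- The law of the normalized record data for the shape `α`. -/
def invariantLaw (n : ℕ) (α : ℝ) : Measure (RecordData n) :=
  (invariantMeasure n).withDensity fun d => ENNReal.ofReal (invariantPDF n α d)

lemma measurable_invariantPDF (n : ℕ) (α : ℝ) : Measurable (invariantPDF n α) := by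
  have hT := measurable_T2star n
  unfold invariantPDF
  fun_prop

lemma invariantPDF_pos {n : ℕ} {α : ℝ} (hα : 0 < α) (d : RecordData n) :
    0 < invariantPDF n α d := by
  unfold invariantPDF; positivity

lemma lintegral_invariantPDF (n : ℕ) {α : ℝ} (hα : 0 < α) :
    ∫⁻ d, ENNReal.ofReal (invariantPDF n α d) ∂(invariantMeasure n) = 1 := by
  have hpr := isProbabilityMeasure_paretoMeasure one_pos hα
  have hpr' : IsProbabilityMeasure (recordLaw n 1 α) :=
    Measure.isProbabilityMeasure_map (measurable_recordData n).aemeasurable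
  have h := lintegral_recordLaw (n := n) one_pos hα (f := fun _ => 1) measurable_const
    fun _ _ _ _ => rfl
  simp only [lintegral_const, measure_univ, one_mul] at h
  exact h.symm

lemma isProbabilityMeasure_invariantLaw (n : ℕ) {α : ℝ} (hα : 0 < α) :
    IsProbabilityMeasure (invariantLaw n α) :=
  ⟨by rw [invariantLaw, withDensity_apply _ MeasurableSet.univ, setLIntegral_univ,
    lintegral_invariantPDF n hα]⟩

lemma integrable_invariantPDF (n : ℕ) {α : ℝ} (hα : 0 < α) :
    Integrable (invariantPDF n α) (invariantMeasure n) := by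
  refine ⟨(measurable_invariantPDF n α).aestronglyMeasurable, ?_⟩
  rw [hasFiniteIntegral_iff_ofReal (ae_of_all _ fun d => (invariantPDF_pos hα d).le),
    lintegral_invariantPDF n hα]
  exact ENNReal.one_lt_top

/-- The power function of an invariant test depends on the shape only. -/
lemma power_eq_integral_invariantLaw {n : ℕ} {β α : ℝ} (hβ : 0 < β) (hα : 0 < α)
    {ψ : RecordData n → ℝ} (hψ : IsTest ψ) (hinv : IsScaleInvariant ψ) :
    power ψ (β, α) = ∫ d, ψ d ∂(invariantLaw n α) := by
  have h0 : ∀ d, 0 ≤ ψ d := fun d => (hψ.mem_Icc d).1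
  rw [power, integral_eq_lintegral_of_nonneg_ae (ae_of_all _ h0) hψ.measurable.aestronglyMeasurable,
    integral_eq_lintegral_of_nonneg_ae (ae_of_all _ h0) hψ.measurable.aestronglyMeasurable,
    lintegral_recordLaw hβ hα hψ.measurable.ennreal_ofReal fun c hc d hd => by rw [hinv c hc d hd],
    invariantLaw, lintegral_withDensity_eq_lintegral_mul _
      (measurable_invariantPDF n α).ennreal_ofReal hψ.measurable.ennreal_ofReal]
  congr 1
  exact lintegral_congr fun d => mul_comm _ _

lemma integral_invariantLaw {n : ℕ} {α : ℝ} (hα : 0 < α) (ψ : RecordData n → ℝ) :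
    ∫ d, ψ d ∂(invariantLaw n α) = ∫ d, ψ d * invariantPDF n α d ∂(invariantMeasure n) := by
  rw [invariantLaw, integral_withDensity_eq_integral_toReal_smul
    (measurable_invariantPDF n α).ennreal_ofReal (ae_of_all _ fun d => ENNReal.ofReal_lt_top)]
  refine integral_congr_ae (ae_of_all _ fun d => ?_)
  dsimp only
  rw [ENNReal.toReal_ofReal (invariantPDF_pos hα d).le, smul_eq_mul, mul_comm]

/-! ### The distribution of the test statistic -/

/-- Two finite measures on `ℝ` whose moment generating functions are finite and equal on a
half-line containing a neighbourhood of `0` coincide: the complex moment generating functions agree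
on a strip that contains the imaginary axis, hence so do the characteristic functions. -/
lemma measure_ext_of_mgf_eq_of_lt {P Q : Measure ℝ} [IsFiniteMeasure P] [IsFiniteMeasure Q] {r : ℝ}
    (hr : 0 < r) (hP : ∀ s < r, Integrable (fun x => Real.exp (s * x)) P)
    (hQ : ∀ s < r, Integrable (fun x => Real.exp (s * x)) Q)
    (h : ∀ s < r, mgf id P s = mgf id Q s) : P = Q := by
  have hsub : ∀ {R : Measure ℝ}, (∀ s < r, Integrable (fun x => Real.exp (s * x)) R) →
      {z : ℂ | z.re < r} ⊆ {z | z.re ∈ interior (integrableExpSet id R)} := fun hR z hz =>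
    interior_maximal (fun s hs => hR s hs) isOpen_Iio hz
  have hconv : IsPreconnected {z : ℂ | z.re < r} :=
    (convex_halfSpace_re_lt r).isPreconnected
  have hreal : ∃ᶠ x : ℝ in 𝓝[≠] 0, complexMGF id P x = complexMGF id Q x := by
    refine Eventually.frequently (nhdsWithin_le_nhds ?_)
    filter_upwards [isOpen_Iio.mem_nhds hr] with x hx
    rw [complexMGF_ofReal, complexMGF_ofReal, h x hx]
  -- identity theorem on the half-plane `re z < r`
  have hEq : EqOn (complexMGF id P) (complexMGF id Q) {z : ℂ | z.re < r} := by
    refine AnalyticOnNhd.eqOn_of_preconnected_of_frequently_eq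
      (analyticOnNhd_complexMGF.mono (hsub hP)) (analyticOnNhd_complexMGF.mono (hsub hQ)) hconv
      (z₀ := ((0 : ℝ) : ℂ)) (by simpa using hr) ?_
    rw [frequently_iff_seq_forall] at hreal ⊢
    obtain ⟨xs, hx_tendsto, hx_eq⟩ := hreal
    refine ⟨fun n => xs n, ?_, hx_eq⟩
    rw [tendsto_nhdsWithin_iff] at hx_tendsto ⊢
    exact ⟨(Complex.continuous_ofReal.tendsto 0).comp hx_tendsto.1, by simpa using hx_tendsto.2⟩
  refine Measure.ext_of_charFun (funext fun t => ?_)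
  rw [← complexMGF_id_mul_I, ← complexMGF_id_mul_I]
  exact hEq (by simpa using hr)

/-- A variant of `measure_ext_of_mgf_eq_of_lt` with Lebesgue integrals. -/
lemma measure_ext_of_lintegral_exp {P Q : Measure ℝ} [IsFiniteMeasure P] [IsFiniteMeasure Q]
    {r : ℝ} (hr : 0 < r) {L : ℝ → ℝ}
    (hP : ∀ s < r, ∫⁻ x, ENNReal.ofReal (Real.exp (s * x)) ∂P = ENNReal.ofReal (L s))
    (hQ : ∀ s < r, ∫⁻ x, ENNReal.ofReal (Real.exp (s * x)) ∂Q = ENNReal.ofReal (L s)) :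
    P = Q := by
  have hm : ∀ s : ℝ, Measurable fun x : ℝ => Real.exp (s * x) := fun s => by fun_prop
  have h0 : ∀ (s : ℝ) (R : Measure ℝ), 0 ≤ᵐ[R] fun x : ℝ => Real.exp (s * x) := fun s R =>
    ae_of_all _ fun x => (Real.exp_pos _).le
  refine measure_ext_of_mgf_eq_of_lt hr (fun s hs => ⟨(hm s).aestronglyMeasurable, ?_⟩)
    (fun s hs => ⟨(hm s).aestronglyMeasurable, ?_⟩) fun s hs => ?_
  · rw [hasFiniteIntegral_iff_ofReal (h0 s P), hP s hs]
    exact ENNReal.ofReal_lt_top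
  · rw [hasFiniteIntegral_iff_ofReal (h0 s Q), hQ s hs]
    exact ENNReal.ofReal_lt_top
  · simp only [mgf, id]
    rw [integral_eq_lintegral_of_nonneg_ae (h0 s P) (hm s).aestronglyMeasurable,
      integral_eq_lintegral_of_nonneg_ae (h0 s Q) (hm s).aestronglyMeasurable, hP s hs, hQ s hs]

/-- The moment generating function of the gamma distribution. -/
lemma lintegral_exp_gammaMeasure {a r s : ℝ} (ha : 0 < a) (hr : 0 < r) (hs : s < r) :
    ∫⁻ x, ENNReal.ofReal (Real.exp (s * x)) ∂(gammaMeasure a r) =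
      ENNReal.ofReal ((r / (r - s)) ^ a) := by
  have hrs : 0 < r - s := sub_pos.mpr hs
  have hm : ∀ b, Measurable (gammaPDF a b) := fun b =>
    (measurable_gammaPDFReal a b).ennreal_ofReal
  rw [gammaMeasure, lintegral_withDensity_eq_lintegral_mul _ (hm r) (by fun_prop)]
  calc _ = ∫⁻ x, ENNReal.ofReal ((r / (r - s)) ^ a) * gammaPDF a (r - s) x := by
        refine lintegral_congr fun x => ?_
        rw [Pi.mul_apply]
        rcases lt_or_ge x 0 with hx | hx
        · rw [gammaPDF_of_neg hx, gammaPDF_of_neg hx, zero_mul, mul_zero]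
        · have h1 := Real.rpow_pos_of_pos hrs a
          have h2 := Real.rpow_pos_of_pos hr a
          rw [gammaPDF_of_nonneg hx, gammaPDF_of_nonneg hx, ← ENNReal.ofReal_mul
            (by positivity), ← ENNReal.ofReal_mul (by positivity), Real.div_rpow hr.le hrs.le]
          congr 1
          rw [show -((r - s) * x) = -(r * x) + s * x by ring, Real.exp_add]
          field_simp
    _ = _ := by
        rw [lintegral_const_mul _ (hm (r - s)), lintegral_gammaPDF_eq_one ha hrs, mul_one]

lemma isProbabilityMeasure_chiSquare {v : ℕ} (hv : 0 < v) : IsProbabilityMeasure (chiSquare v) :=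
  isProbabilityMeasure_gammaMeasure (by positivity) (by norm_num)

/-- `2 α T₂*` has the chi-square distribution with `2 (m - 1)` degrees of freedom. Its moment
generating function is known because the densities `invariantPDF n α` integrate to `1` for all
`α > 0`. -/
theorem map_T2star_invariantLaw {n : ℕ} (hn : 1 ≤ n) {α : ℝ} (hα : 0 < α) :
    (invariantLaw n α).map (fun d => 2 * α * T2star d) = chiSquare (2 * n) := by
  have hQ := isProbabilityMeasure_invariantLaw n hα
  have hχ := isProbabilityMeasure_chiSquare (v := 2 * n) (by omega)
  have hT := measurable_T2star n
  have hTm : Measurable fun d : RecordData n => 2 * α * T2star d := by fun_prop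
  have hP := Measure.isProbabilityMeasure_map (μ := invariantLaw n α) hTm.aemeasurable
  refine measure_ext_of_lintegral_exp (r := 1 / 2)
    (L := fun s => ((1 / 2) / (1 / 2 - s)) ^ ((2 * n : ℕ) / 2 : ℝ)) (by norm_num)
    (fun s hs => ?_) fun s hs => ?_
  · have ha : 0 < α * (1 - 2 * s) := mul_pos hα (by linarith)
    rw [lintegral_map (by fun_prop) hTm, invariantLaw, lintegral_withDensity_eq_lintegral_mul _
      (measurable_invariantPDF n α).ennreal_ofReal (by fun_prop)]
    -- tilting by `exp (2 α s T₂*)` changes the shape from `α` to `α (1 - 2 s)`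
    calc _ = ∫⁻ d, ENNReal.ofReal ((1 / (1 - 2 * s)) ^ n) *
          ENNReal.ofReal (invariantPDF n (α * (1 - 2 * s)) d) ∂(invariantMeasure n) := by
          refine lintegral_congr fun d => ?_
          have h1 : 0 < 1 - 2 * s := by linarith
          rw [Pi.mul_apply, ← ENNReal.ofReal_mul (invariantPDF_pos hα d).le,
            ← ENNReal.ofReal_mul (by positivity)]
          congr 1
          unfold invariantPDF
          rw [mul_assoc, ← Real.exp_add, mul_pow, div_pow, one_pow]
          rw [show -(α * T2star d) + s * (2 * α * T2star d) = -(α * (1 - 2 * s) * T2star d) by ring]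
          field_simp
      _ = _ := by
          rw [lintegral_const_mul _ (measurable_invariantPDF n _).ennreal_ofReal,
            lintegral_invariantPDF n ha, mul_one]
          have h2 : ((2 * n : ℕ) / 2 : ℝ) = n := by push_cast; ring
          rw [h2, Real.rpow_natCast]
          have h1 : 1 - 2 * s ≠ 0 := by linarith
          have h3 : 1 / 2 - s ≠ 0 := by linarith
          congr 2
          field_simp
  · rw [chiSquare, lintegral_exp_gammaMeasure (by positivity) (by norm_num) hs]

lemma continuous_cdf_of_nullSingletonClass (P : Measure ℝ) [IsProbabilityMeasure P]
    [NullSingletonClass P] : Continuous (cdf P) := by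
  refine continuous_iff_continuousAt.mpr fun x => ?_
  rw [(monotone_cdf P).continuousAt_iff_leftLim_eq_rightLim, StieltjesFunction.rightLim_eq]
  refine le_antisymm ((monotone_cdf P).leftLim_le le_rfl) ?_
  have h := StieltjesFunction.measure_singleton (cdf P) x
  rw [measure_cdf, measure_singleton, eq_comm, ENNReal.ofReal_eq_zero] at h
  linarith

instance nullSingletonClass_chiSquare (v : ℕ) : NullSingletonClass (chiSquare v) :=
  inferInstanceAs (NullSingletonClass (gammaMeasure _ _))

/-- The quantile is an exact inverse of the cdf, because the chi-square law has no atoms. -/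
lemma cdf_chiSquareQuantile {v : ℕ} (hv : 0 < v) {p : ℝ} (hp₀ : 0 < p) (hp₁ : p < 1) :
    cdf (chiSquare v) (chiSquareQuantile v p) = p := by
  have hχ := isProbabilityMeasure_chiSquare hv
  have hc := continuous_cdf_of_nullSingletonClass (chiSquare v)
  have hmono := monotone_cdf (chiSquare v)
  obtain ⟨a, ha⟩ := ((tendsto_cdf_atBot (chiSquare v)).eventually (gt_mem_nhds hp₀)).exists
  obtain ⟨b, hb⟩ := ((tendsto_cdf_atTop (chiSquare v)).eventually (lt_mem_nhds hp₁)).exists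
  obtain ⟨q, hq⟩ := mem_range_of_exists_le_of_exists_ge hc ⟨a, ha.le⟩ ⟨b, hb.le⟩
  have hbdd : BddBelow {q : ℝ | p ≤ cdf (chiSquare v) q} :=
    ⟨a, fun x hx => le_of_not_gt fun hxa => (hx.trans (hmono hxa.le)).not_gt ha⟩
  have hne : {q : ℝ | p ≤ cdf (chiSquare v) q}.Nonempty := ⟨q, hq.ge⟩
  refine le_antisymm ?_ ((isClosed_le continuous_const hc).csInf_mem hne hbdd)
  exact (hmono (csInf_le hbdd (show q ∈ {q : ℝ | p ≤ cdf (chiSquare v) q} from hq.ge))).trans hq.le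

lemma chiSquareQuantile_nonneg {v : ℕ} (hv : 0 < v) {p : ℝ} (hp₀ : 0 < p) (hp₁ : p < 1) :
    0 ≤ chiSquareQuantile v p := by
  have hχ := isProbabilityMeasure_chiSquare hv
  by_contra! hneg
  have h := cdf_chiSquareQuantile hv hp₀ hp₁
  have h0 : chiSquare v (Iic (chiSquareQuantile v p)) = 0 := by
    refine measure_mono_null (Iic_subset_Iio.mpr hneg) ?_
    rw [chiSquare, gammaMeasure, withDensity_apply _ measurableSet_Iio]
    exact lintegral_gammaPDF_of_nonpos le_rfl
  rw [← ofReal_cdf, h, ENNReal.ofReal_eq_zero] at h0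
  linarith

/-! ### Optimality -/

/-- The Neyman–Pearson lemma. The sign condition says that `φ` rejects where `p₁ > κ p₀` and accepts
where `p₁ < κ p₀`. -/
lemma integral_mul_le_of_likelihood_ratio {Ω : Type*} {mΩ : MeasurableSpace Ω} {ν : Measure Ω}
    {p₀ p₁ φ ψ : Ω → ℝ} {κ : ℝ} (hκ : 0 ≤ κ) (hp₀ : Integrable p₀ ν) (hp₁ : Integrable p₁ ν)
    (hφ : Measurable φ) (hψ : Measurable ψ) (hφ' : ∀ d, φ d ∈ Icc (0 : ℝ) 1)
    (hψ' : ∀ d, ψ d ∈ Icc (0 : ℝ) 1) (hsign : ∀ d, 0 ≤ (φ d - ψ d) * (p₁ d - κ * p₀ d))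
    (hsize : ∫ d, ψ d * p₀ d ∂ν ≤ ∫ d, φ d * p₀ d ∂ν) :
    ∫ d, ψ d * p₁ d ∂ν ≤ ∫ d, φ d * p₁ d ∂ν := by
  have hint : ∀ {χ p : Ω → ℝ}, Measurable χ → (∀ d, χ d ∈ Icc (0 : ℝ) 1) → Integrable p ν →
      Integrable (fun d => χ d * p d) ν := fun {χ p} hχ hχ' hp =>
    hp.bdd_mul (c := 1) hχ.aestronglyMeasurable (ae_of_all _ fun d => by
      rw [Real.norm_eq_abs, abs_of_nonneg (hχ' d).1]; exact (hχ' d).2)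
  have h := integral_nonneg (μ := ν) (f := fun d => (φ d - ψ d) * (p₁ d - κ * p₀ d)) hsign
  have heq : ∀ d, (φ d - ψ d) * (p₁ d - κ * p₀ d) =
      (φ d * p₁ d - ψ d * p₁ d) - κ * (φ d * p₀ d - ψ d * p₀ d) := fun d => by ring
  have i1 := hint hφ hφ' hp₁
  have i2 := hint hψ hψ' hp₁
  have i3 := hint hφ hφ' hp₀
  have i4 := hint hψ hψ' hp₀
  simp_rw [heq] at h
  have i5 : Integrable (fun d => φ d * p₁ d - ψ d * p₁ d) ν := i1.sub i2
  have i6 : Integrable (fun d => φ d * p₀ d - ψ d * p₀ d) ν := i3.sub i4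
  rw [integral_sub i5 (i6.const_mul κ), integral_const_mul, integral_sub i1 i2,
    integral_sub i3 i4] at h
  nlinarith [mul_nonneg hκ (sub_nonneg.mpr hsize)]

lemma T2star_div {n : ℕ} {c : ℝ} (hc : 0 < c) {d : RecordData n} (hd : d ∈ sampleSpace n) :
    T2star ((fun i => d.1 i / c, d.2) : RecordData n) = T2star d := by
  refine Finset.sum_congr rfl fun i _ => ?_
  dsimp only
  rw [Real.log_div (hd.1 _).ne' hc.ne', Real.log_div (hd.1 _).ne' hc.ne']
  ring

/-- A test that depends on the data through `T₂*` only. -/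
lemma isTest_indicator_T2star {n : ℕ} {B : Set ℝ} (hB : MeasurableSet B) :
    IsTest ((T2star ⁻¹' B).indicator fun _ : RecordData n => (1 : ℝ)) where
  measurable := measurable_const.indicator (measurable_T2star n hB)
  mem_Icc d := by
    by_cases h : d ∈ T2star ⁻¹' B
    · rw [indicator_of_mem h]; simp
    · rw [indicator_of_notMem h]; simp

lemma isScaleInvariant_indicator_T2star {n : ℕ} (B : Set ℝ) :
    IsScaleInvariant ((T2star ⁻¹' B).indicator fun _ : RecordData n => (1 : ℝ)) := by
  intro c hc d hd
  classical
  simp only [indicator_apply, mem_preimage, T2star_div hc hd]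

lemma power_indicator_T2star {n : ℕ} (hn : 1 ≤ n) {β α : ℝ} (hβ : 0 < β) (hα : 0 < α) {B : Set ℝ}
    (hB : MeasurableSet B) :
    power ((T2star ⁻¹' B).indicator fun _ : RecordData n => (1 : ℝ)) (β, α) =
      (chiSquare (2 * n)).real {x | x / (2 * α) ∈ B} := by
  have hT := measurable_T2star n
  have hB' : MeasurableSet {x : ℝ | x / (2 * α) ∈ B} := (measurable_id.div_const (2 * α)) hB
  rw [power_eq_integral_invariantLaw hβ hα (isTest_indicator_T2star hB)
    (isScaleInvariant_indicator_T2star B), integral_indicator_const _ (measurable_T2star n hB),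
    smul_eq_mul, mul_one, ← map_T2star_invariantLaw hn hα, map_measureReal_apply (by fun_prop) hB']
  congr 1
  ext d
  have h : 2 * α * T2star d / (2 * α) = T2star d := by field_simp
  simp [h]

/-- A test in `T₂*` is UMP invariant if its size is attained at the boundary value `α₀` and the
likelihood ratio of every alternative shape against `α₀` crosses a constant where the test
switches between rejection and acceptance. -/
lemma isUMPInvariantTest_of_likelihood_ratio {n : ℕ} {H₀ H₁ : Set (ℝ × ℝ)} {γ α₀ : ℝ}
    (hα₀ : 0 < α₀) (hmem : ((1 : ℝ), α₀) ∈ H₀)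
    (hH₁ : ∀ θ ∈ H₁, 0 < θ.1 ∧ 0 < θ.2) {B : Set ℝ} (hB : MeasurableSet B)
    (hsize : power ((T2star ⁻¹' B).indicator fun _ : RecordData n => (1 : ℝ)) (1, α₀) = γ)
    (hlevel : ∀ θ ∈ H₀, power ((T2star ⁻¹' B).indicator fun _ : RecordData n => (1 : ℝ)) θ ≤ γ)
    (hratio : ∀ θ ∈ H₁, ∃ κ, 0 ≤ κ ∧ ∀ d : RecordData n,
      (T2star d ∈ B → κ * invariantPDF n α₀ d ≤ invariantPDF n θ.2 d) ∧
      (T2star d ∉ B → invariantPDF n θ.2 d ≤ κ * invariantPDF n α₀ d)) :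
    IsUMPInvariantTest H₀ H₁ γ
      ((T2star ⁻¹' B).indicator fun _ : RecordData n => (1 : ℝ)) where
  isTest := isTest_indicator_T2star hB
  invariant := isScaleInvariant_indicator_T2star B
  size_eq := IsGreatest.isLUB ⟨⟨_, hmem, hsize⟩, by rintro _ ⟨θ, hθ, rfl⟩; exact hlevel θ hθ⟩
  most_powerful ψ hψ hinv hψlevel := by
    rintro ⟨β, α⟩ hθ
    obtain ⟨hβ, hα⟩ := hH₁ _ hθ
    obtain ⟨κ, hκ, hd⟩ := hratio _ hθ
    have hφ := isTest_indicator_T2star (n := n) hB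
    have hφinv := isScaleInvariant_indicator_T2star (n := n) B
    have h0 := hψlevel _ hmem
    rw [← hsize, power_eq_integral_invariantLaw one_pos hα₀ hψ hinv,
      power_eq_integral_invariantLaw one_pos hα₀ hφ hφinv, integral_invariantLaw hα₀,
      integral_invariantLaw hα₀] at h0
    rw [power_eq_integral_invariantLaw hβ hα hψ hinv,
      power_eq_integral_invariantLaw hβ hα hφ hφinv, integral_invariantLaw hα,
      integral_invariantLaw hα]
    refine integral_mul_le_of_likelihood_ratio hκ (integrable_invariantPDF n hα₀)
      (integrable_invariantPDF n hα) hφ.measurable hψ.measurable hφ.mem_Icc hψ.mem_Icc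
      (fun d => ?_) h0
    have h1 := hψ.mem_Icc d
    by_cases hdB : d ∈ T2star ⁻¹' B
    · rw [indicator_of_mem hdB]
      exact mul_nonneg (sub_nonneg.mpr h1.2) (sub_nonneg.mpr ((hd d).1 hdB))
    · rw [indicator_of_notMem hdB]
      exact mul_nonneg_of_nonpos_of_nonpos (by linarith [h1.1]) (sub_nonpos.mpr ((hd d).2 hdB))

/-- The densities for the shapes `α₁` and `α₀` are proportional to `exp (-(α₁ - α₀) T₂*)`; the
factor `κ` makes them equal on `T₂* = c`. -/
lemma invariantPDF_sub {n : ℕ} {α₀ : ℝ} (hα₀ : 0 < α₀) (α₁ c : ℝ) (d : RecordData n) :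
    invariantPDF n α₁ d -
        (α₁ ^ n / α₀ ^ n * Real.exp (-((α₁ - α₀) * c))) * invariantPDF n α₀ d =
      α₁ ^ n * Real.exp (-(α₀ * T2star d)) *
        (Real.exp (-((α₁ - α₀) * T2star d)) - Real.exp (-((α₁ - α₀) * c))) := by
  unfold invariantPDF
  rw [show -(α₁ * T2star d) = -(α₀ * T2star d) + -((α₁ - α₀) * T2star d) by ring, Real.exp_add]
  field_simp

theorem isUMPInvariantTest_lower {n : ℕ} (hn : 1 ≤ n) {α₀ : ℝ} (hα₀ : 0 < α₀) {γ : ℝ}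
    (hγ₀ : 0 < γ) (hγ₁ : γ < 1) :
    IsUMPInvariantTest {θ : ℝ × ℝ | 0 < θ.1 ∧ 0 < θ.2 ∧ θ.2 ≤ α₀}
      {θ : ℝ × ℝ | 0 < θ.1 ∧ 0 < θ.2 ∧ α₀ < θ.2} γ
      ((T2star ⁻¹' Iic (chiSquareQuantile (2 * n) γ / (2 * α₀))).indicator
        fun _ : RecordData n => (1 : ℝ)) := by
  set q := chiSquareQuantile (2 * n) γ with hq
  have hχ := isProbabilityMeasure_chiSquare (v := 2 * n) (by omega)
  have hcdf : (chiSquare (2 * n)).real (Iic q) = γ := by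
    rw [← cdf_eq_real, hq, cdf_chiSquareQuantile (by omega) hγ₀ hγ₁]
  have hq0 : 0 ≤ q := chiSquareQuantile_nonneg (by omega) hγ₀ hγ₁
  refine isUMPInvariantTest_of_likelihood_ratio hα₀
    (by exact ⟨one_pos, hα₀, le_rfl⟩) (fun θ hθ => ⟨hθ.1, hθ.2.1⟩) measurableSet_Iic ?_ ?_ ?_
  · rw [power_indicator_T2star hn one_pos hα₀ measurableSet_Iic, ← hcdf]
    congr 1
    ext x
    simp only [mem_ofPred_eq, mem_Iic]
    exact div_le_div_iff_of_pos_right (by positivity)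
  · rintro ⟨β, α⟩ ⟨hβ, hα, hle⟩
    dsimp only at hβ hα hle
    rw [power_indicator_T2star hn hβ hα measurableSet_Iic, ← hcdf]
    -- the critical value is nonnegative, so a smaller shape shrinks the rejection region
    refine measureReal_mono fun x hx => ?_
    simp only [mem_ofPred_eq, mem_Iic] at hx ⊢
    rw [div_le_div_iff₀ (by positivity) (by positivity)] at hx
    nlinarith
  · rintro ⟨β, α⟩ ⟨-, hα, hlt⟩
    dsimp only at hα hlt
    refine ⟨α ^ n / α₀ ^ n * Real.exp (-((α - α₀) * (q / (2 * α₀)))), by positivity, fun d =>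
      ⟨fun h => sub_nonneg.mp ?_, fun h => sub_nonpos.mp ?_⟩⟩
    · rw [mem_Iic] at h
      rw [invariantPDF_sub hα₀]
      refine mul_nonneg (by positivity) (sub_nonneg.mpr (Real.exp_le_exp.mpr ?_))
      nlinarith
    · rw [mem_Iic, not_le] at h
      rw [invariantPDF_sub hα₀]
      refine mul_nonpos_of_nonneg_of_nonpos (by positivity)
        (sub_nonpos.mpr (Real.exp_le_exp.mpr ?_))
      nlinarith

theorem isUMPInvariantTest_upper {n : ℕ} (hn : 1 ≤ n) {α₀ : ℝ} (hα₀ : 0 < α₀) {γ : ℝ}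
    (hγ₀ : 0 < γ) (hγ₁ : γ < 1) :
    IsUMPInvariantTest {θ : ℝ × ℝ | 0 < θ.1 ∧ 0 < θ.2 ∧ α₀ ≤ θ.2}
      {θ : ℝ × ℝ | 0 < θ.1 ∧ 0 < θ.2 ∧ θ.2 < α₀} γ
      ((T2star ⁻¹' Ici (chiSquareQuantile (2 * n) (1 - γ) / (2 * α₀))).indicator
        fun _ : RecordData n => (1 : ℝ)) := by
  set q := chiSquareQuantile (2 * n) (1 - γ) with hq
  have hχ := isProbabilityMeasure_chiSquare (v := 2 * n) (by omega)
  have hcdf : (chiSquare (2 * n)).real (Ici q) = γ := by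
    rw [← compl_Iio, probReal_compl_eq_one_sub measurableSet_Iio,
      measureReal_congr Iio_ae_eq_Iic, ← cdf_eq_real, hq,
      cdf_chiSquareQuantile (by omega) (by linarith) (by linarith)]
    ring
  have hq0 : 0 ≤ q := chiSquareQuantile_nonneg (by omega) (by linarith) (by linarith)
  refine isUMPInvariantTest_of_likelihood_ratio hα₀
    (by exact ⟨one_pos, hα₀, le_rfl⟩) (fun θ hθ => ⟨hθ.1, hθ.2.1⟩) measurableSet_Ici ?_ ?_ ?_
  · rw [power_indicator_T2star hn one_pos hα₀ measurableSet_Ici, ← hcdf]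
    congr 1
    ext x
    simp only [mem_ofPred_eq, mem_Ici]
    exact div_le_div_iff_of_pos_right (by positivity)
  · rintro ⟨β, α⟩ ⟨hβ, hα, hle⟩
    dsimp only at hβ hα hle
    rw [power_indicator_T2star hn hβ hα measurableSet_Ici, ← hcdf]
    refine measureReal_mono fun x hx => ?_
    simp only [mem_ofPred_eq, mem_Ici] at hx ⊢
    rw [div_le_div_iff₀ (by positivity) (by positivity)] at hx
    nlinarith
  · rintro ⟨β, α⟩ ⟨-, hα, hlt⟩
    dsimp only at hα hlt
    refine ⟨α ^ n / α₀ ^ n * Real.exp (-((α - α₀) * (q / (2 * α₀)))), by positivity, fun d =>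
      ⟨fun h => sub_nonneg.mp ?_, fun h => sub_nonpos.mp ?_⟩⟩
    · rw [mem_Ici] at h
      rw [invariantPDF_sub hα₀]
      refine mul_nonneg (by positivity) (sub_nonneg.mpr (Real.exp_le_exp.mpr ?_))
      nlinarith
    · rw [mem_Ici, not_le] at h
      rw [invariantPDF_sub hα₀]
      refine mul_nonpos_of_nonneg_of_nonpos (by positivity)
        (sub_nonpos.mpr (Real.exp_le_exp.mpr ?_))
      nlinarith

end ParetoRecords

end

/-- One-sided testing of the Pareto shape `α`, with the scale `β` unknown, from the first
`m = n + 1 ≥ 2` lower records (so `2 * n = 2 * m - 2`). Parameters are `θ = (β, α)`. -/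
theorem mainTheorem1 (n : ℕ) (hn : 1 ≤ n) (α₀ : ℝ) (hα₀ : 0 < α₀)
    (γ : ℝ) (hγ₀ : 0 < γ) (hγ₁ : γ < 1) :
    ParetoRecords.IsUMPInvariantTest
      {θ : ℝ × ℝ | 0 < θ.1 ∧ 0 < θ.2 ∧ θ.2 ≤ α₀}
      {θ : ℝ × ℝ | 0 < θ.1 ∧ 0 < θ.2 ∧ α₀ < θ.2} γ
      (Set.indicator {d : ParetoRecords.RecordData n |
        2 * α₀ * ParetoRecords.T2star d ≤ ParetoRecords.chiSquareQuantile (2 * n) γ}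
        (fun _ => (1 : ℝ))) ∧
    ParetoRecords.IsUMPInvariantTest
      {θ : ℝ × ℝ | 0 < θ.1 ∧ 0 < θ.2 ∧ α₀ ≤ θ.2}
      {θ : ℝ × ℝ | 0 < θ.1 ∧ 0 < θ.2 ∧ θ.2 < α₀} γ
      (Set.indicator {d : ParetoRecords.RecordData n |
        ParetoRecords.chiSquareQuantile (2 * n) (1 - γ) ≤ 2 * α₀ * ParetoRecords.T2star d}
        (fun _ => (1 : ℝ))) := by
  have h2 : 0 < 2 * α₀ := by positivity
  have hlower : ∀ q : ℝ, {d : ParetoRecords.RecordData n | 2 * α₀ * ParetoRecords.T2star d ≤ q} =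
      ParetoRecords.T2star ⁻¹' Set.Iic (q / (2 * α₀)) := fun q => by
    ext d
    simp only [Set.mem_ofPred_eq, Set.mem_preimage, Set.mem_Iic, le_div_iff₀' h2]
  have hupper : ∀ q : ℝ, {d : ParetoRecords.RecordData n | q ≤ 2 * α₀ * ParetoRecords.T2star d} =
      ParetoRecords.T2star ⁻¹' Set.Ici (q / (2 * α₀)) := fun q => by
    ext d
    simp only [Set.mem_ofPred_eq, Set.mem_preimage, Set.mem_Ici, div_le_iff₀' h2]
  rw [hlower, hupper]
  exact ⟨ParetoRecords.isUMPInvariantTest_lower hn hα₀ hγ₀ hγ₁,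
    ParetoRecords.isUMPInvariantTest_upper hn hα₀ hγ₀ hγ₁⟩
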